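/- Let $T$ be a complete first-order theory in a countable language $L$ that is $\omega$-categorical, i.e. any two countably infinite models of $T$ are isomorphic. For a natural number $n$, an $L$-formula is called an *$n$-formula* of $T$ if it is $T$-equivalent to a Boolean combination of $L$-formulas each of which has at most $n$ free variables. The theory $T$ is called *almost $n$-ary* if there are finitely many $L$-formulas $\varphi_1(\overline{x}),\ldots,\varphi_m(\overline{x})$ such that every $L$-formula is $T$-equivalent to a Boolean combination of $n$-formulas and of formulas obtained from $\varphi_1,\ldots,\varphi_m$ by substituting variables (not necessarily distinct) for their free variables. Let $\mathrm{aar}(T)$ be the least $n\ge 1$ such that $T$ is almost $n$-ary, with $\mathrm{aar}(T)=\infty$ if there is no such $n$. If $T$ is almost $n$-ary for some natural number $n$, then $T$ is almost $k$-ary for every natural number $k\ge 1$; consequently $\mathrm{aar}(T)=1$. -/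

import Mathlib

universe u v w

namespace AlmostArity

open FirstOrder FirstOrder.Language

variable {L : FirstOrder.Language.{u, v}}

/-- `IsBooleanCombination S φ`: the formula `φ` is a Boolean combination of formulas
from the set `S` (the constants false and true being allowed). -/
inductive IsBooleanCombination (S : Set (L.Formula ℕ)) : L.Formula ℕ → Prop
  | of {φ : L.Formula ℕ} (h : φ ∈ S) : IsBooleanCombination S φ
  | falsum : IsBooleanCombination S ⊥
  | neg {φ : L.Formula ℕ} (h : IsBooleanCombination S φ) : IsBooleanCombination S φ.not
  | conj {φ ψ : L.Formula ℕ} (h₁ : IsBooleanCombination S φ) (h₂ : IsBooleanCombination S ψ) :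
      IsBooleanCombination S (φ ⊓ ψ)
  | disj {φ ψ : L.Formula ℕ} (h₁ : IsBooleanCombination S φ) (h₂ : IsBooleanCombination S ψ) :
      IsBooleanCombination S (φ ⊔ ψ)

/-- `φ` is equivalent, modulo the theory `T`, to a Boolean combination of formulas from `S`. -/
def IsBasedOn (T : L.Theory) (S : Set (L.Formula ℕ)) (φ : L.Formula ℕ) : Prop :=
  ∃ ψ : L.Formula ℕ, IsBooleanCombination S ψ ∧ φ ⇔[T] ψ

/-- `φ` is an `n`-formula of `T`: it is `T`-equivalent to a Boolean combination of formulas,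
each of the form `θ(x₁, …, xₙ)`, that is, with free variables among `n` variables. The first-order
variables are indexed by `ℕ`. -/
def IsNFormula (T : L.Theory) (n : ℕ) (φ : L.Formula ℕ) : Prop :=
  IsBasedOn T {θ : L.Formula ℕ | θ.freeVarFinset.card ≤ n} φ

/-- The formulas obtained from members of `Φ` by substituting variables (not necessarily distinct)
for the free variables. -/
def substitutions (Φ : Set (L.Formula ℕ)) : Set (L.Formula ℕ) :=
  {θ : L.Formula ℕ | ∃ φ ∈ Φ, ∃ σ : ℕ → ℕ, θ = Formula.relabel σ φ}

/-- The formulas in `Φ` witness that `T` is almost `n`-ary. -/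
def WitnessAlmostAry (T : L.Theory) (n : ℕ) (Φ : Set (L.Formula ℕ)) : Prop :=
  ∀ φ : L.Formula ℕ, IsBasedOn T ({θ | IsNFormula T n θ} ∪ substitutions Φ) φ

/-- `T` is almost `n`-ary: finitely many formulas witness this. -/
def AlmostAry (T : L.Theory) (n : ℕ) : Prop :=
  ∃ Φ : Set (L.Formula ℕ), Φ.Finite ∧ WitnessAlmostAry T n Φ

/-- `aar T` is the least `n ≥ 1` such that `T` is almost `n`-ary, and `∞` if there is none. -/
noncomputable def aar (T : L.Theory) : ℕ∞ :=
  sInf {a : ℕ∞ | ∃ n : ℕ, 1 ≤ n ∧ AlmostAry T n ∧ a = n}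

end AlmostArity

/-!
By the Ryll-Nardzewski theorem, an `ω`-categorical complete theory in a countable language has only
finitely many formulas in `n` variables up to equivalence. Once representatives of these are added
to the witnessing formulas, every `n`-formula is based on substitution instances of witnesses, so
`n`-formulas are no longer needed and the theory is almost `k`-ary for every `k`.

The finiteness is a Baire category argument. The space of `n`-types is compact, so if it were
infinite, it would contain a non-isolated type `q`. In the Baire space of types in the variables
`ℕ`, the types `tp(a)` for which the entries of `a` form an elementary substructure are comeager.
So are those for which no substitution instance of `tp(a)` in `n` variables is `q`, because
substitution of variables induces continuous open maps between type spaces, along which comeager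
sets pull back. A type of both kinds yields a countable model omitting `q`, and this model cannot be
isomorphic to a countable model realizing `q`.
-/

namespace AlmostArity

open FirstOrder FirstOrder.Language

section TypeSpace

variable {L : FirstOrder.Language.{u, v}} {T : L.Theory} {α : Type*}

/-- The set of complete types of `T` that contain the formula `φ`: `Theory.typesWith` for a formula
with free variables in place of a sentence with constants. -/
def typesWithFormula (T : L.Theory) (φ : L.Formula α) : Set (T.CompleteType α) :=
  T.typesWith (Formula.equivSentence φ)

theorem typeOf_mem_typesWithFormula {M : Type*} [L.Structure M] [Nonempty M] [M ⊨ T] {v : α → M}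
    {φ : L.Formula α} : T.typeOf v ∈ typesWithFormula T φ ↔ φ.Realize v :=
  Theory.CompleteType.formula_mem_typeOf

theorem isTopologicalBasis_range_typesWithFormula :
    TopologicalSpace.IsTopologicalBasis (Set.range (typesWithFormula T : L.Formula α → _)) := by
  have h := CompleteType.isTopologicalBasis_range_typesWith (T := T) (α := α)
  rwa [← Formula.equivSentence.surjective.range_comp] at h

theorem isClopen_typesWithFormula (φ : L.Formula α) : IsClopen (typesWithFormula T φ) :=
  CompleteType.isClopen_typesWith _

theorem iff_of_forall_realize {α : Type w} {φ ψ : L.Formula α}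
    (h : ∀ (M : Type (max u v w)) [L.Structure M] [Nonempty M] [M ⊨ T] (v : α → M),
      φ.Realize v ↔ ψ.Realize v) : φ ⇔[T] ψ :=
  Theory.models_formula_iff.2 fun M v => Formula.realize_iff.2 (h M v)

theorem iff_of_typesWithFormula_eq {φ ψ : L.Formula α}
    (h : typesWithFormula T φ = typesWithFormula T ψ) : φ ⇔[T] ψ :=
  iff_of_forall_realize fun M _ _ _ v => by
    rw [← typeOf_mem_typesWithFormula (T := T), h, typeOf_mem_typesWithFormula]

theorem exists_finite_formula_representatives [Finite (T.CompleteType α)] :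
    ∃ R : Set (L.Formula α), R.Finite ∧ ∀ φ : L.Formula α, ∃ ρ ∈ R, φ ⇔[T] ρ := by
  obtain ⟨R, -, hR⟩ := Set.exists_subset_bijOn Set.univ (typesWithFormula T : L.Formula α → _)
  refine ⟨R, hR.finite_iff_finite.2 (Set.toFinite _), fun φ => ?_⟩
  obtain ⟨ρ, hρ, hφρ⟩ := hR.surjOn ⟨φ, Set.mem_univ φ, rfl⟩
  exact ⟨ρ, hρ, iff_of_typesWithFormula_eq hφρ.symm⟩

theorem typeOf_comp_elementaryEmbedding {M N : Type*} [L.Structure M] [L.Structure N]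
    [Nonempty M] [Nonempty N] [M ⊨ T] [N ⊨ T] (f : M ↪ₑ[L] N) (v : α → M) :
    T.typeOf (f ∘ v) = T.typeOf v :=
  SetLike.ext fun φ => by
    rw [Theory.CompleteType.mem_typeOf, Theory.CompleteType.mem_typeOf, f.map_formula]

theorem exists_realize_iff_realize_exClosure [DecidableEq α] (φ : L.Formula α) (M : Type*)
    [L.Structure M] [Nonempty M] : (∃ v : α → M, φ.Realize v) ↔ M ⊨ φ.exClosure := by
  rw [← Formula.exists_realize_equivSentence_iff_realize_exClosure]
  refine exists_congr fun v => ?_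
  rw [← Formula.realize_equivSentence_symm, _root_.Equiv.symm_apply_apply]

theorem dense_realizedTypes_of_isComplete (hT : T.IsComplete) (M : Type*) [L.Structure M]
    [Nonempty M] [M ⊨ T] : Dense (T.realizedTypes M α) := by
  classical
  rw [isTopologicalBasis_range_typesWithFormula.dense_iff]
  rintro _ ⟨φ, rfl⟩ ⟨p, hp⟩
  obtain ⟨N, v, rfl⟩ := T.exists_modelType_is_realized_in p
  have hN : N ⊨ φ.exClosure :=
    (exists_realize_iff_realize_exClosure φ N).1 ⟨v, typeOf_mem_typesWithFormula.1 hp⟩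
  have hM : M ⊨ φ.exClosure :=
    (elementarilyEquivalent_iff.1 (hT.models_elementarily_equivalent N M) _).1 hN
  obtain ⟨w, hw⟩ := (exists_realize_iff_realize_exClosure φ M).2 hM
  exact ⟨T.typeOf w, typeOf_mem_typesWithFormula.2 hw, w, rfl⟩

end TypeSpace

section Substitution

variable {L : FirstOrder.Language.{u, v}} {T : L.Theory} {α β : Type*}

/-- The map on complete types induced by a substitution of variables `s`: it sends the type of a
tuple `v` to the type of `v ∘ s`. -/
def typeComap (s : β → α) (p : T.CompleteType α) : T.CompleteType β where
  toTheory := {φ | Formula.equivSentence ((Formula.equivSentence.symm φ).relabel s) ∈ p}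
  subset' := by
    obtain ⟨M, v, rfl⟩ := T.exists_modelType_is_realized_in p
    convert (T.typeOf (v ∘ s)).subset using 1
    ext
    simp [Formula.realize_relabel]
  isMaximal' := by
    obtain ⟨M, v, rfl⟩ := T.exists_modelType_is_realized_in p
    convert (T.typeOf (v ∘ s)).isMaximal using 1
    ext
    simp [Formula.realize_relabel]

theorem typeComap_typeOf {M : Type*} [L.Structure M] [Nonempty M] [M ⊨ T] (s : β → α)
    (v : α → M) : typeComap s (T.typeOf v) = T.typeOf (v ∘ s) :=
  SetLike.ext fun _ => (Theory.CompleteType.formula_mem_typeOf (T := T)).trans <|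
    Formula.realize_relabel.trans Theory.CompleteType.mem_typeOf.symm

theorem preimage_typeComap_typesWithFormula (s : β → α) (φ : L.Formula β) :
    typeComap s ⁻¹' typesWithFormula T φ = typesWithFormula T (φ.relabel s) := by
  ext p
  obtain ⟨M, v, rfl⟩ := T.exists_modelType_is_realized_in p
  rw [Set.mem_preimage, typeComap_typeOf, typeOf_mem_typesWithFormula,
    typeOf_mem_typesWithFormula, Formula.realize_relabel]

theorem continuous_typeComap (s : β → α) :
    Continuous (typeComap s : T.CompleteType α → T.CompleteType β) := by
  rw [isTopologicalBasis_range_typesWithFormula.continuous_iff]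
  rintro _ ⟨φ, rfl⟩
  rw [preimage_typeComap_typesWithFormula]
  exact (isClopen_typesWithFormula _).isOpen

/-- The formula `∃ v, θ(v) ∧ v ∘ s = w` in the variables `w`, where only the variables that occur
in `θ` or in the range of `s` are quantified. -/
noncomputable def substImage [DecidableEq α] [Fintype β] (s : β → α) (θ : L.Formula α) :
    L.Formula β :=
  let F : Finset α := θ.freeVarFinset ∪ Finset.univ.image s
  let θ' : L.Formula (β ⊕ F) := BoundedFormula.restrictFreeVar θ
    fun a => Sum.inr ⟨a, Finset.mem_union_left _ a.2⟩
  let agree (b : β) : L.Formula (β ⊕ F) := (Term.var (Sum.inl b)).equal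
    (Term.var (Sum.inr ⟨s b, Finset.mem_union_right _ (Finset.mem_image_of_mem s (by simp))⟩))
  (θ' ⊓ Formula.iInf agree).iExs F

theorem realize_substImage [DecidableEq α] [Fintype β] {M : Type*} [L.Structure M] [Nonempty M]
    (s : β → α) (θ : L.Formula α) {w : β → M} :
    (substImage s θ).Realize w ↔ ∃ v : α → M, θ.Realize v ∧ v ∘ s = w := by
  simp only [substImage, Formula.realize_iExs, Formula.realize_inf, Formula.realize_iInf,
    Formula.realize_equal, Term.realize_var, Sum.elim_inl, Sum.elim_inr]
  have realize_θ (v : α → M) := BoundedFormula.realize_restrictFreeVar (φ := θ) (xs := default)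
    (f := fun a => Sum.inr ⟨a.1, Finset.mem_union_left (Finset.univ.image s) a.2⟩)
    (v := Sum.elim w (v ∘ Subtype.val)) v fun _ => rfl
  constructor
  · rintro ⟨x, hθ, hx⟩
    obtain ⟨v, rfl⟩ := Subtype.val_injective.surjective_comp_right x
    exact ⟨v, (realize_θ v).1 hθ, funext fun b => (hx b).symm⟩
  · rintro ⟨v, hθ, rfl⟩
    exact ⟨v ∘ Subtype.val, (realize_θ v).2 hθ, fun _ => rfl⟩

theorem isOpenMap_typeComap [Finite β] (s : β → α) :
    IsOpenMap (typeComap s : T.CompleteType α → T.CompleteType β) := by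
  classical
  cases nonempty_fintype β
  rw [isTopologicalBasis_range_typesWithFormula.isOpenMap_iff]
  rintro _ ⟨θ, rfl⟩
  suffices typeComap s '' typesWithFormula T θ = typesWithFormula T (substImage s θ) from
    this ▸ (isClopen_typesWithFormula _).isOpen
  ext q
  constructor
  · rintro ⟨p, hp, rfl⟩
    obtain ⟨M, v, rfl⟩ := T.exists_modelType_is_realized_in p
    rw [typeComap_typeOf, typeOf_mem_typesWithFormula, realize_substImage]
    exact ⟨v, typeOf_mem_typesWithFormula.1 hp, rfl⟩
  · intro hq
    obtain ⟨M, w, rfl⟩ := T.exists_modelType_is_realized_in q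
    rw [typeOf_mem_typesWithFormula, realize_substImage] at hq
    obtain ⟨v, hv, rfl⟩ := hq
    exact ⟨T.typeOf v, typeOf_mem_typesWithFormula.2 hv, typeComap_typeOf s v⟩

end Substitution

section OmittingTypes

variable {L : FirstOrder.Language.{u, v}} {T : L.Theory} {α β : Type*}

/-- The complete types for which `∃ x, φ(v, x)`, if it holds, is witnessed by one of the variables
`v` themselves. -/
def henkinTypes (T : L.Theory) (φ : L.Formula (α ⊕ Fin 1)) : Set (T.CompleteType α) :=
  (typesWithFormula T (φ.iExs (Fin 1)))ᶜ ∪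
    ⋃ i : α, typesWithFormula T (φ.relabel (Sum.elim id fun _ => i))

theorem typeOf_mem_henkinTypes {M : Type*} [L.Structure M] [Nonempty M] [M ⊨ T] {v : α → M}
    {φ : L.Formula (α ⊕ Fin 1)} : T.typeOf v ∈ henkinTypes T φ ↔
      ((∃ x, φ.Realize (Sum.elim v x)) → ∃ i, φ.Realize (Sum.elim v fun _ => v i)) := by
  simp only [henkinTypes, Set.mem_union, Set.mem_compl_iff, Set.mem_iUnion,
    typeOf_mem_typesWithFormula, Formula.realize_iExs, Formula.realize_relabel, Sum.comp_elim,
    Function.comp_id, imp_iff_not_or]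
  rfl

theorem isOpen_henkinTypes (φ : L.Formula (α ⊕ Fin 1)) : IsOpen (henkinTypes T φ) :=
  (isClopen_typesWithFormula _).compl.isOpen.union
    (isOpen_iUnion fun _ => (isClopen_typesWithFormula _).isOpen)

theorem realize_congr_freeVarFinset [DecidableEq α] {M : Type*} [L.Structure M]
    (φ : L.Formula α) {v w : α → M} (h : ∀ a ∈ φ.freeVarFinset, v a = w a) :
    φ.Realize v ↔ φ.Realize w :=
  (BoundedFormula.realize_restrictFreeVar (f := Subtype.val) v fun _ => rfl).symm.trans
    (BoundedFormula.realize_restrictFreeVar w fun a => h a a.2)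

theorem dense_henkinTypes [Infinite α] (φ : L.Formula (α ⊕ Fin 1)) :
    Dense (henkinTypes T φ) := by
  classical
  rw [isTopologicalBasis_range_typesWithFormula.dense_iff]
  rintro _ ⟨θ, rfl⟩ ⟨p, hp⟩
  obtain ⟨M, v, rfl⟩ := T.exists_modelType_is_realized_in p
  by_cases hφ : ∃ x, φ.Realize (Sum.elim v x)
  · obtain ⟨x, hx⟩ := hφ
    -- A variable that occurs in neither formula can be reassigned to the witness `x`.
    obtain ⟨i, hi⟩ := Infinite.exists_notMem_finset (θ.freeVarFinset ∪ φ.freeVarFinset.toLeft)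
    rw [Finset.notMem_union, Finset.mem_toLeft] at hi
    have hθ : θ.Realize (Function.update v i (x 0)) :=
      (realize_congr_freeVarFinset θ fun a ha =>
        Function.update_of_ne (ne_of_mem_of_not_mem ha hi.1) _ _).2
        (typeOf_mem_typesWithFormula.1 hp)
    refine ⟨T.typeOf (Function.update v i (x 0)), typeOf_mem_typesWithFormula.2 hθ,
      typeOf_mem_henkinTypes.2 fun _ => ⟨i, (realize_congr_freeVarFinset φ ?_).2 hx⟩⟩
    rintro (a | a) ha
    · exact Function.update_of_ne (fun h : a = i => hi.2 (h ▸ ha)) _ _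
    · simp [Subsingleton.elim a 0]
  · exact ⟨_, hp, typeOf_mem_henkinTypes.2 fun h => absurd h hφ⟩

theorem meetsDefinable_range_of_typeOf_mem_henkinTypes {M : Type*} [L.Structure M] [Nonempty M]
    [M ⊨ T] {a : α → M} (ha : ∀ φ, T.typeOf a ∈ henkinTypes T φ) :
    L.MeetsDefinable (Set.range a) := by
  rintro D ⟨d, hd⟩ hD
  obtain ⟨φ, hφ⟩ := Set.definable_iff_exists_formula_sum.1 hD
  choose r hr using fun y : Set.range a => y.2
  have mem_iff (x : Fin 1 → M) :
      (φ.relabel (Sum.map r id)).Realize (Sum.elim a x) ↔ x 0 ∈ D := by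
    have hr' : a ∘ r = Subtype.val := funext hr
    rw [Formula.realize_relabel, Sum.elim_comp_map, hr', Function.comp_id]
    exact (Set.ext_iff.1 hφ x).symm
  obtain ⟨i, hi⟩ := typeOf_mem_henkinTypes.1 (ha (φ.relabel (Sum.map r id)))
    ⟨fun _ => d, (mem_iff _).2 hd⟩
  exact ⟨a i, (mem_iff _).1 hi, i, rfl⟩

theorem exists_countable_model_realizedTypes_subset [Countable L.Symbols] [Finite β]
    (hT : T.IsSatisfiable) {U : Set (T.CompleteType β)} (hU : U ∈ residual (T.CompleteType β)) :
    ∃ N : Theory.ModelType.{u, v, max u v} T, Countable N ∧ T.realizedTypes N β ⊆ U := by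
  have : Nonempty (T.CompleteType ℕ) := Theory.CompleteType.nonempty_iff.2 hT
  have henkin : ∀ᶠ p in residual (T.CompleteType ℕ), ∀ φ, p ∈ henkinTypes T φ :=
    eventually_countable_forall.2 fun φ =>
      residual_of_dense_open (isOpen_henkinTypes φ) (dense_henkinTypes φ)
  have comap_mem : ∀ᶠ p in residual (T.CompleteType ℕ), ∀ s : β → ℕ, typeComap s p ∈ U :=
    eventually_countable_forall.2 fun s =>
      tendsto_residual_of_isOpenMap (continuous_typeComap s) (isOpenMap_typeComap s) hU
  obtain ⟨p, hp, hpU⟩ := (dense_of_mem_residual (henkin.and comap_mem)).nonempty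
  obtain ⟨M, a, rfl⟩ := T.exists_modelType_is_realized_in p
  have meets := meetsDefinable_range_of_typeOf_mem_henkinTypes hp
  let E : L.ElementarySubstructure M := meets.toElementarySubstructure
  have hE : (E : Set M) = Set.range a := meets.closure_eq_self
  have : Countable (E : Set M) := hE ▸ (Set.countable_range a).to_subtype
  refine ⟨E.toModel T, this, ?_⟩
  rintro _ ⟨w, rfl⟩
  choose s hs using fun b => hE.subset (w b).2
  have comp_s : a ∘ s = Subtype.val ∘ w := funext hs
  have typeOf_w : T.typeOf w = typeComap s (T.typeOf a) := by
    rw [typeComap_typeOf, comp_s]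
    exact (typeOf_comp_elementaryEmbedding E.subtype w).symm
  exact typeOf_w ▸ hpU s

end OmittingTypes

section RyllNardzewski

variable {L : FirstOrder.Language.{u, v}} {T : L.Theory}

theorem exists_countable_model_realizing [Countable L.Symbols] {α : Type w} [Countable α]
    (p : T.CompleteType α) :
    ∃ N : Theory.ModelType.{u, v, max u v w} T, Countable N ∧ p ∈ T.realizedTypes N α := by
  obtain ⟨M, a, rfl⟩ := T.exists_modelType_is_realized_in p
  rcases le_total (Cardinal.mk M) Cardinal.aleph0 with hM | hM
  · exact ⟨M, Cardinal.mk_le_aleph0_iff.1 hM, a, rfl⟩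
  · have range_le : Cardinal.mk (Set.range a) ≤ Cardinal.aleph0 :=
      Cardinal.mk_le_aleph0_iff.2 (Set.countable_range a).to_subtype
    have card_le : L.card ≤ Cardinal.aleph0 := Cardinal.mk_le_aleph0_iff.2 ‹_›
    obtain ⟨E, haE, hE⟩ := exists_elementarySubstructure_card_eq L (Set.range a)
      Cardinal.aleph0.{0} le_rfl (by rwa [Cardinal.lift_aleph0, Cardinal.lift_le_aleph0])
      (by rwa [Cardinal.lift_aleph0, Cardinal.lift_le_aleph0])
      (by rwa [Cardinal.lift_aleph0, Cardinal.aleph0_le_lift])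
    have : Countable E := Cardinal.mk_le_aleph0_iff.1 (by simpa using hE.le)
    let b (i : α) : E.toModel T := ⟨a i, haE ⟨i, rfl⟩⟩
    exact ⟨E.toModel T, this, b, (typeOf_comp_elementaryEmbedding E.subtype b).symm⟩

theorem exists_modelType_aleph0_equiv (M : Type*) [L.Structure M] [Nonempty M] [M ⊨ T]
    [Countable M] [Infinite M] :
    ∃ N : Theory.ModelType.{u, v, w} T, Cardinal.mk N = Cardinal.aleph0 ∧ Nonempty (M ≃[L] N) := by
  obtain ⟨e⟩ : Nonempty (M ≃ ULift.{w} ℕ) := nonempty_equiv_of_countable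
  exact ⟨Theory.ModelType.equivInduced (M := Theory.ModelType.of T M) e,
    Cardinal.mk_eq_aleph0 (ULift.{w} ℕ), ⟨@Equiv.inducedStructureEquiv L M (ULift.{w} ℕ) _ e⟩⟩

theorem nonempty_equiv_of_categorical (hcat : Cardinal.aleph0.{w}.Categorical T) (M N : Type*)
    [L.Structure M] [L.Structure N] [Nonempty M] [Nonempty N] [M ⊨ T] [N ⊨ T]
    [Countable M] [Countable N] [Infinite M] [Infinite N] : Nonempty (M ≃[L] N) := by
  obtain ⟨M', hM', ⟨f⟩⟩ := exists_modelType_aleph0_equiv.{u, v, w} (T := T) M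
  obtain ⟨N', hN', ⟨g⟩⟩ := exists_modelType_aleph0_equiv.{u, v, w} (T := T) N
  obtain ⟨h⟩ := hcat M' N' hM' hN'
  exact ⟨g.symm.comp (h.comp f)⟩

theorem infinite_of_isComplete (hT : T.IsComplete) (M N : Type*) [L.Structure M] [L.Structure N]
    [Nonempty M] [Nonempty N] [M ⊨ T] [N ⊨ T] [Infinite M] : Infinite N :=
  (hT.models_elementarily_equivalent M N).infinite_iff.1 ‹_›

theorem finite_completeType_of_finite (hT : T.IsComplete) (M : Type*) [L.Structure M] [Nonempty M]
    [M ⊨ T] [Finite M] (β : Type*) [Finite β] : Finite (T.CompleteType β) := by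
  have finite_realized : (T.realizedTypes M β).Finite := Set.finite_range (T.typeOf : (β → M) → _)
  have realized_eq_univ : T.realizedTypes M β = Set.univ :=
    finite_realized.isClosed.closure_eq ▸ (dense_realizedTypes_of_isComplete hT M).closure_eq
  exact Set.finite_univ_iff.1 (realized_eq_univ ▸ finite_realized)

theorem finite_completeType_of_categorical [Countable L.Symbols] (hT : T.IsComplete)
    (hcat : Cardinal.aleph0.{w}.Categorical T) (β : Type*) [Finite β] :
    Finite (T.CompleteType β) := by
  obtain ⟨M⟩ := hT.1
  cases finite_or_infinite M
  · exact finite_completeType_of_finite hT M β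
  suffices DiscreteTopology (T.CompleteType β) from finite_of_compact_of_discrete
  rw [discreteTopology_iff_isOpen_singleton]
  by_contra! ⟨q, hq⟩
  have compl_residual : {q}ᶜ ∈ residual (T.CompleteType β) :=
    residual_of_dense_open isOpen_compl_singleton (dense_compl_singleton_iff_not_open.2 hq)
  obtain ⟨N, _, q_omitted⟩ := exists_countable_model_realizedTypes_subset hT.1 compl_residual
  obtain ⟨N', _, b, rfl⟩ := exists_countable_model_realizing q
  have : Infinite N := infinite_of_isComplete hT M N
  have : Infinite N' := infinite_of_isComplete hT M N'
  obtain ⟨f⟩ := nonempty_equiv_of_categorical hcat N' N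
  exact q_omitted ⟨f ∘ b, rfl⟩ (typeOf_comp_elementaryEmbedding f.toElementaryEmbedding b)

end RyllNardzewski

section AlmostAry

variable {L : FirstOrder.Language.{u, v}} {T : L.Theory} {S S' : Set (L.Formula ℕ)}
  {φ : L.Formula ℕ}

theorem isBasedOn_of_mem (h : φ ∈ S) : IsBasedOn T S φ :=
  ⟨φ, .of h, Theory.Iff.refl _⟩

theorem IsBooleanCombination.isBasedOn (hS : ∀ θ ∈ S, IsBasedOn T S' θ)
    (h : IsBooleanCombination S φ) : IsBasedOn T S' φ := by
  induction h with
  | of h => exact hS _ h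
  | falsum => exact ⟨⊥, .falsum, Theory.Iff.refl _⟩
  | neg _ ih =>
    obtain ⟨χ, hχ, h⟩ := ih
    exact ⟨χ.not, hχ.neg, h.not⟩
  | conj _ _ ih₁ ih₂ =>
    obtain ⟨χ₁, hχ₁, h₁⟩ := ih₁
    obtain ⟨χ₂, hχ₂, h₂⟩ := ih₂
    refine ⟨χ₁ ⊓ χ₂, hχ₁.conj hχ₂, iff_of_forall_realize fun M _ _ _ v => ?_⟩
    rw [Formula.realize_inf, Formula.realize_inf, h₁.realize_iff, h₂.realize_iff]
  | disj _ _ ih₁ ih₂ =>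
    obtain ⟨χ₁, hχ₁, h₁⟩ := ih₁
    obtain ⟨χ₂, hχ₂, h₂⟩ := ih₂
    refine ⟨χ₁ ⊔ χ₂, hχ₁.disj hχ₂, iff_of_forall_realize fun M _ _ _ v => ?_⟩
    rw [Formula.realize_sup, Formula.realize_sup, h₁.realize_iff, h₂.realize_iff]

theorem IsBasedOn.trans (h : IsBasedOn T S φ) (hS : ∀ θ ∈ S, IsBasedOn T S' θ) :
    IsBasedOn T S' φ := by
  obtain ⟨ψ, hψ, hφψ⟩ := h
  obtain ⟨χ, hχ, hψχ⟩ := hψ.isBasedOn hS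
  exact ⟨χ, hχ, hφψ.trans hψχ⟩

theorem substitutions_mono (h : S ⊆ S') : substitutions S ⊆ substitutions S' := by
  rintro _ ⟨φ, hφ, σ, rfl⟩
  exact ⟨φ, h hφ, σ, rfl⟩

theorem isBasedOn_substitutions_of_card_freeVarFinset_le {n : ℕ} {R : Set (L.Formula (Fin n))}
    (hR : ∀ ψ : L.Formula (Fin n), ∃ ρ ∈ R, ψ ⇔[T] ρ) (hφ : φ.freeVarFinset.card ≤ n) :
    IsBasedOn T (substitutions (Formula.relabel (Fin.val : Fin n → ℕ) '' R)) φ := by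
  let e : φ.freeVarFinset ↪ Fin n :=
    φ.freeVarFinset.equivFin.toEmbedding.trans (Fin.castLEEmb hφ)
  let σ : ℕ → ℕ := Function.extend (Fin.val ∘ e) Subtype.val id
  have σ_e (a : φ.freeVarFinset) : σ (e a) = a :=
    (Fin.val_injective.comp e.injective).extend_apply Subtype.val id a
  obtain ⟨ρ, hρ, hφρ⟩ := hR (BoundedFormula.restrictFreeVar φ e)
  refine ⟨(ρ.relabel Fin.val).relabel σ, .of ⟨_, ⟨ρ, hρ, rfl⟩, σ, rfl⟩,
    iff_of_forall_realize fun M _ _ _ v => ?_⟩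
  rw [Formula.realize_relabel, Formula.realize_relabel, ← hφρ.realize_iff]
  exact (BoundedFormula.realize_restrictFreeVar (v := (v ∘ σ) ∘ Fin.val) v
    fun a => congrArg v (σ_e a)).symm

theorem AlmostAry.of_finite_completeType {n : ℕ} (h : AlmostAry T n)
    [Finite (T.CompleteType (Fin n))] (k : ℕ) : AlmostAry T k := by
  obtain ⟨Φ, hΦ, witness⟩ := h
  obtain ⟨R, R_finite, hR⟩ := exists_finite_formula_representatives (T := T) (α := Fin n)
  let Ψ := Φ ∪ Formula.relabel (Fin.val : Fin n → ℕ) '' R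
  have of_substitution {χ} (hχ : χ ∈ substitutions Ψ) :
      IsBasedOn T ({θ | IsNFormula T k θ} ∪ substitutions Ψ) χ :=
    isBasedOn_of_mem (Or.inr hχ)
  refine ⟨Ψ, hΦ.union (R_finite.image _), fun φ => (witness φ).trans ?_⟩
  rintro θ (hθ | hθ)
  · exact hθ.trans fun η hη =>
      (isBasedOn_substitutions_of_card_freeVarFinset_le hR hη).trans fun χ hχ =>
        of_substitution (substitutions_mono Set.subset_union_right hχ)
  · exact of_substitution (substitutions_mono Set.subset_union_left hθ)

theorem aar_eq_one (h : AlmostAry T 1) : aar T = 1 := by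
  refine le_antisymm (sInf_le ⟨1, le_rfl, h, by simp⟩) (le_sInf ?_)
  rintro _ ⟨n, hn, -, rfl⟩
  exact_mod_cast hn

end AlmostAry

end AlmostArity

theorem mainTheorem5 (L : FirstOrder.Language.{u, v}) (hL : L.card ≤ Cardinal.aleph0)
    (T : L.Theory) (hT : T.IsComplete) (hcat : (Cardinal.aleph0.{w}).Categorical T)
    (n : ℕ) (hn : AlmostArity.AlmostAry T n) :
    (∀ k : ℕ, 1 ≤ k → AlmostArity.AlmostAry T k) ∧ AlmostArity.aar T = 1 := by
  have : Countable L.Symbols := Cardinal.mk_le_aleph0_iff.1 hL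
  have : Finite (T.CompleteType (Fin n)) :=
    AlmostArity.finite_completeType_of_categorical hT hcat (Fin n)
  exact ⟨fun k _ => hn.of_finite_completeType k,
    AlmostArity.aar_eq_one (hn.of_finite_completeType 1)⟩
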